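/- A kei (involutory quandle) is a set $Q$ with a binary operation $\ast$ such that (a) $x\ast(y\ast z)=(x\ast y)\ast(x\ast z)$ for all $x,y,z\in Q$; (b) for all $x,z\in Q$ there is a unique $y\in Q$ with $x\ast y=z$; (c) $x\ast x=x$ for all $x\in Q$; (d) $x\ast(x\ast y)=y$ for all $x,y\in Q$. Let $X_{Kei}$ be the set of all kei operations on $\mathbb{N}$, a standard Borel space with the Borel structure inherited from $\mathbb{N}^{\mathbb{N}\times\mathbb{N}}$. For $K,M\in X_{Kei}$, say that $K$ embeds into $M$, written $K\sqsubseteq_{Kei}M$, if there is an injection $f\colon\mathbb{N}\to\mathbb{N}$ with $f(x\ast_K y)=f(x)\ast_M f(y)$ for all $x,y$; and let $\cong_{Kei}$ be isomorphism, i.e. the existence of a bijective such $f$. A relation $P$ on a standard Borel space $X$ is $\boldsymbol{\Sigma}^1_1$ if it is the projection of a Borel subset of $X^2\times Z$ for some Polish space $Z$. A quasi-order is a reflexive and transitive relation. For relations $P$ on $X$ and $R$ on $Y$, $P$ is Borel reducible to $R$ if there is a Borel map $f\colon X\to Y$ with $x\mathrel{P}y\iff f(x)\mathrel{R}f(y)$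 for all $x,y\in X$. Theorem. The embeddability relation between countable kei is invariantly universal. That is, $\sqsubseteq_{Kei}$ is a $\boldsymbol{\Sigma}^1_1$ quasi-order on $X_{Kei}$, $\cong_{Kei}$ is a $\boldsymbol{\Sigma}^1_1$ equivalence relation contained in $\sqsubseteq_{Kei}$, and for every $\boldsymbol{\Sigma}^1_1$ quasi-order $R$ on a standard Borel space there is a Borel set $B\subseteq X_{Kei}$, closed under isomorphism, such that $R$ and the restriction of $\sqsubseteq_{Kei}$ to $B$ are Borel reducible to each other. -/

import Mathlib

universe u v w

/-- A subset `A` of a standard Borel space `X` is `Σ¹₁` (analytic) if it is the projection of a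
Borel subset of `X × Z` for some Polish space `Z`. (Every Polish space is homeomorphic to one in
`Type`, so it is no restriction that `Z` lives there.) -/
def IsSigma11 {X : Type u} [MeasurableSpace X] (A : Set X) : Prop :=
  ∃ (Z : Type) (_ : TopologicalSpace Z) (_ : PolishSpace Z) (_ : MeasurableSpace Z)
    (_ : BorelSpace Z) (B : Set (X × Z)), MeasurableSet B ∧ A = {x | ∃ z, (x, z) ∈ B}

/-- A binary relation on `X` is `Σ¹₁` if its graph is a `Σ¹₁` subset of `X × X`. -/
def IsSigma11Rel {X : Type u} [MeasurableSpace X] (P : X → X → Prop) : Prop :=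
  IsSigma11 {p : X × X | P p.1 p.2}

/-- `Σ¹₁` quasi-orders: reflexive transitive `Σ¹₁` relations. -/
structure IsSigma11QuasiOrder {X : Type u} [MeasurableSpace X] (P : X → X → Prop) : Prop where
  refl : ∀ x, P x x
  trans : ∀ x y z, P x y → P y z → P x z
  sigma11 : IsSigma11Rel P

/-- `P` is Borel reducible to `R`. -/
def BorelReducible {X : Type u} {Y : Type v} [MeasurableSpace X] [MeasurableSpace Y]
    (P : X → X → Prop) (R : Y → Y → Prop) : Prop :=
  ∃ f : X → Y, Measurable f ∧ ∀ x y, P x y ↔ R (f x) (f y)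

/-- `P` is essentially `R`: each is Borel reducible to the other. -/
def BorelBireducible {X : Type u} {Y : Type v} [MeasurableSpace X] [MeasurableSpace Y]
    (P : X → X → Prop) (R : Y → Y → Prop) : Prop :=
  BorelReducible P R ∧ BorelReducible R P

/-- The restriction of a relation to a subset. -/
def restrictRel {X : Type u} (P : X → X → Prop) (B : Set X) : B → B → Prop :=
  fun x y => P x y

/-- `B` is invariant with respect to `E`. -/
def InvariantUnder {X : Type u} (E : X → X → Prop) (B : Set X) : Prop :=
  ∀ x y, E x y → x ∈ B → y ∈ B

/-- `(P, E)` is invariantly universal: `P` is a `Σ¹₁` quasi-order on the standard Borel space `X`,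
`E ⊆ P` is a `Σ¹₁` equivalence relation, and every `Σ¹₁` quasi-order on a standard Borel space is
Borel bi-reducible with the restriction of `P` to some `E`-invariant Borel subset of `X`. -/
structure InvariantlyUniversal {X : Type u} [MeasurableSpace X] [StandardBorelSpace X]
    (P E : X → X → Prop) : Prop where
  quasiOrder : IsSigma11QuasiOrder P
  equivalence : Equivalence E
  sigma11 : IsSigma11Rel E
  subrelation : ∀ x y, E x y → P x y
  universal : ∀ (Y : Type w) [MeasurableSpace Y] [StandardBorelSpace Y] (R : Y → Y → Prop),
    IsSigma11QuasiOrder R →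
      ∃ B : Set X, MeasurableSet B ∧ InvariantUnder E B ∧ BorelBireducible (restrictRel P B) R

/-- The quandle axioms for a binary operation. -/
structure IsQuandle {Q : Type u} (op : Q → Q → Q) : Prop where
  distrib : ∀ x y z, op x (op y z) = op (op x y) (op x z)
  existsUnique : ∀ x z, ∃! y, op x y = z
  idem : ∀ x, op x x = x

/-- A kei is an involutory quandle. -/
structure IsKei {Q : Type u} (op : Q → Q → Q) : Prop extends IsQuandle op where
  invol : ∀ x y, op x (op x y) = y

/-- The space of countable kei: kei operations with domain `ℕ`, with the Borel structure induced
from the product space `ℕ → ℕ → ℕ` (`ℕ` being discrete). -/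
abbrev KeiSpace : Type := {op : ℕ → ℕ → ℕ // IsKei op}

theorem measurable_eval_op (x y : ℕ) : Measurable fun op : ℕ → ℕ → ℕ => op x y :=
  (measurable_pi_apply y).comp (measurable_pi_apply x)

theorem measurable_eval_op_comp {f g : (ℕ → ℕ → ℕ) → ℕ} (hf : Measurable f) (hg : Measurable g) :
    Measurable fun op : ℕ → ℕ → ℕ => op (f op) (g op) := by
  have h : Measurable fun p : (ℕ → ℕ → ℕ) × (ℕ × ℕ) => p.1 p.2.1 p.2.2 :=
    measurable_from_prod_countable_left fun p => measurable_eval_op p.1 p.2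
  exact h.comp (measurable_id.prodMk (hf.prodMk hg))

theorem measurableSet_isKei : MeasurableSet {op : ℕ → ℕ → ℕ | IsKei op} := by
  have key : {op : ℕ → ℕ → ℕ | IsKei op} =
      (⋂ (x) (y) (z), {op | op x (op y z) = op (op x y) (op x z)}) ∩
        ((⋂ x, {op | op x x = x}) ∩ ⋂ (x) (y), {op | op x (op x y) = y}) := by
    ext op
    simp only [Set.mem_inter_iff, Set.mem_iInter, Set.mem_ofPred_eq]
    refine ⟨fun h => ⟨h.distrib, h.idem, h.invol⟩, fun ⟨h1, h2, h3⟩ => ⟨⟨h1, ?_, h2⟩, h3⟩⟩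
    exact fun x z => ⟨op x z, h3 x z, fun y hy => by rw [← hy, h3]⟩
  have m := measurable_eval_op
  have c : ∀ x : ℕ, Measurable fun _ : ℕ → ℕ → ℕ => x := fun x => measurable_const
  rw [key]
  refine MeasurableSet.inter ?_ (MeasurableSet.inter ?_ ?_)
  · exact .iInter fun x => .iInter fun y => .iInter fun z => measurableSet_eq_fun
      (measurable_eval_op_comp (c x) (m y z)) (measurable_eval_op_comp (m x y) (m x z))
  · exact .iInter fun x => measurableSet_eq_fun (m x x) (c x)
  · exact .iInter fun x => .iInter fun y =>
      measurableSet_eq_fun (measurable_eval_op_comp (c x) (m x y)) (c y)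

instance KeiSpace.standardBorelSpace : StandardBorelSpace KeiSpace :=
  measurableSet_isKei.standardBorel

/-- Embeddability between countable kei. -/
def KeiEmbeds (K M : KeiSpace) : Prop :=
  ∃ f : ℕ → ℕ, Function.Injective f ∧ ∀ x y, f (K.1 x y) = M.1 (f x) (f y)

/-- Isomorphism between countable kei. -/
def KeiIso (K M : KeiSpace) : Prop :=
  ∃ f : Equiv.Perm ℕ, ∀ x y, f (K.1 x y) = M.1 (f x) (f y)

/-! ### Analytic quasi-orders as subadditive families of relations -/

/-! Analytic quasi-orders have a combinatorial normal form. Code points in the Cantor space by a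
Borel injection `e`, so that the image of the relation is the range of a continuous `f` on the Baire
space. `Chain f n u v s` approximates, to `n` coordinates, a finite path from `u` to `v` inside that
range, where `s` bounds both the number of links and the witness of each link. It is monotone, holds
from `u` to `u` with bound `0`, and composes by adding the bounds (`Chain.add`). As bounded
witnesses range over a compact set, `x` lies below `y` iff a single `α` bounds chains from `e x` to
`e y` at all precisions.

To `v` attach the tree `wordSet f v` of words whose bits are chained to `v` with bound the numbers
of the word. Adding such an `α` to the numbers carries the tree of `u` into that of `v`, by
additivity. Conversely, a bit-preserving tree map, followed along the words with bits from `u` and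
numbers `0`, reads off an `α`. The tree becomes a digraph in which a rigid hub marks the bits and an
`ω`-chain below each node carries the numbers. Embeddings then act on the numbers below a node by
strictly increasing maps, so isomorphisms are the identity.

In the associated kei, over two copies of each vertex, the copies of a vertex are exchanged by some
hub element, and adjacency means failing to fix. Hence kei embeddings and induced digraph embeddings
amount to the same thing, and the only automorphisms left exchange copies of vertices. Requiring the
first copy to be listed first removes these. Each isomorphic copy thus comes from exactly one pair
(point, normalized indexing), so by Lusin–Souslin the copies form a Borel set on which the point is
recovered in a Borel way. -/

/-- The pair coded by a point `β` agrees with `(u, v)` below `n`, and `β` is bounded by the shift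
of `s` below `n - 1`. -/
def Step (f : (ℕ → ℕ) → (ℕ → Bool) × (ℕ → Bool)) (n : ℕ) (u v : ℕ → Bool) (s : ℕ → ℕ) : Prop :=
  ∃ β, (∀ i < n, (f β).1 i = u i) ∧ (∀ i < n, (f β).2 i = v i) ∧ ∀ i, i + 1 < n → β i ≤ s (i + 1)

/-- `u` and `v` are joined, up to precision `n`, by a chain of at most `s 0` steps. -/
def Chain (f : (ℕ → ℕ) → (ℕ → Bool) × (ℕ → Bool)) (n : ℕ) (u v : ℕ → Bool) (s : ℕ → ℕ) : Prop :=
  ∃ k ≤ s 0, ∃ p : ℕ → ℕ → Bool, (∀ i < n, p 0 i = u i) ∧ (∀ i < n, p k i = v i) ∧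
    ∀ j < k, Step f n (p j) (p (j + 1)) s

section

variable {f : (ℕ → ℕ) → (ℕ → Bool) × (ℕ → Bool)} {m n : ℕ} {u u' v v' w : ℕ → Bool} {s s' : ℕ → ℕ}

theorem Step.mono (h : Step f n u v s) (hmn : m ≤ n) (hu : ∀ i < m, u i = u' i)
    (hv : ∀ i < m, v i = v' i) (hs : ∀ i < m, s i ≤ s' i) : Step f m u' v' s' := by
  obtain ⟨β, h1, h2, h3⟩ := h
  exact ⟨β, fun i hi => (h1 i (by omega)).trans (hu i hi),
    fun i hi => (h2 i (by omega)).trans (hv i hi),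
    fun i hi => (h3 i (by omega)).trans (hs _ hi)⟩

theorem chain_zero : Chain f 0 u v s :=
  ⟨0, Nat.zero_le _, fun _ => u, by simp, by simp, by simp⟩

theorem Chain.mono (h : Chain f n u v s) (hmn : m ≤ n) (hu : ∀ i < m, u i = u' i)
    (hv : ∀ i < m, v i = v' i) (hs : ∀ i < m, s i ≤ s' i) : Chain f m u' v' s' := by
  -- For `m = 0` nothing compares `s 0` with `s' 0`, but then the chain without links suffices.
  rcases Nat.eq_zero_or_pos m with rfl | hm
  · exact chain_zero
  obtain ⟨k, hk, p, h0, hk', hp⟩ := h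
  exact ⟨k, hk.trans (hs 0 hm), p, fun i hi => (h0 i (by omega)).trans (hu i hi),
    fun i hi => (hk' i (by omega)).trans (hv i hi),
    fun j hj => (hp j hj).mono hmn (fun _ _ => rfl) (fun _ _ => rfl) hs⟩

theorem chain_self : Chain f n u u s :=
  ⟨0, Nat.zero_le _, fun _ => u, by simp, by simp, by simp⟩

theorem Chain.eq_of_zero (h : Chain f n u v fun _ => 0) : ∀ i < n, u i = v i := by
  obtain ⟨k, hk, p, h0, hk', -⟩ := h
  obtain rfl : k = 0 := by simpa using hk
  exact fun i hi => (h0 i hi).symm.trans (hk' i hi)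

/-- Concatenate the two chains. At the junction `p k` replaces `q 0`; both agree with `v` below `n`,
which is all that a link sees. -/
theorem Chain.add (h : Chain f n u v s) (h' : Chain f n v w s') : Chain f n u w (s + s') := by
  obtain ⟨k, hk, p, h0, hk1, hp⟩ := h
  obtain ⟨l, hl, q, h0', hl1, hq⟩ := h'
  refine ⟨k + l, Nat.add_le_add hk hl, fun j => if j ≤ k then p j else q (j - k), ?_, ?_, ?_⟩
  · simpa using h0
  · intro i hi
    rcases Nat.eq_zero_or_pos l with rfl | hl0
    · simpa using (hk1 i hi).trans ((h0' i hi).symm.trans (hl1 i hi))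
    · simpa [hl0.ne'] using hl1 i hi
  · intro j hj
    rcases lt_or_ge j k with hjk | hjk
    · simpa [hjk.le, Nat.succ_le_of_lt hjk] using
        (hp j hjk).mono le_rfl (fun _ _ => rfl) (fun _ _ => rfl) fun i _ => by simp
    · have e : j + 1 - k = j - k + 1 := by omega
      have h1 := (hq (j - k) (by omega)).mono (s' := s + s') (u' := if j ≤ k then p j else q (j - k))
        le_rfl (fun i hi => ?_) (fun _ _ => rfl) fun i _ => by simp
      · simpa [show ¬ j + 1 ≤ k by omega, e] using h1
      · split_ifs with hle
        · obtain rfl : j = k := le_antisymm hle hjk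
          simpa using (h0' i hi).trans (hk1 i hi).symm
        · rfl

/-! ### Compactness along a nonprincipal ultrafilter -/

theorem Filter.eventually_hyperfilter_gt (m : ℕ) :
    ∀ᶠ n in (Filter.hyperfilter ℕ : Filter ℕ), m < n :=
  Nat.hyperfilter_le_atTop (Filter.eventually_gt_atTop m)

theorem Ultrafilter.exists_eventually_eq_of_le (U : Ultrafilter ℕ) (g : ℕ → ℕ) (b : ℕ)
    (h : ∀ᶠ n in U, g n ≤ b) : ∃ a ≤ b, ∀ᶠ n in U, g n = a := by
  have := (Ultrafilter.eventually_exists_mem_iff (f := U) (P := fun a n => g n = a)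
    (Set.finite_Iic b)).1 (h.mono fun n hn => ⟨g n, hn, rfl⟩)
  simpa using this

theorem Ultrafilter.exists_eventually_eq {α : Type*} [Finite α] (U : Ultrafilter ℕ) (g : ℕ → α) :
    ∃ a, ∀ᶠ n in U, g n = a :=
  Ultrafilter.eventually_exists_iff.1 (.of_forall fun n => ⟨g n, rfl⟩)

/-- Each coordinate of the witnesses is eventually bounded, so they converge along the ultrafilter
to a point, whose image under `f` is `(u, v)` by continuity. -/
theorem mem_range_of_forall_step (hf : Continuous f) (h : ∀ n, Step f n u v s) :
    (u, v) ∈ Set.range f := by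
  choose β h1 h2 h3 using h
  set U := Filter.hyperfilter ℕ
  have hβ : ∀ i, ∃ a, ∀ᶠ n in U, β n i = a := fun i => by
    obtain ⟨a, -, ha⟩ := U.exists_eventually_eq_of_le (fun n => β n i) (s (i + 1))
      ((Filter.eventually_hyperfilter_gt (i + 1)).mono fun n hn => h3 n i hn)
    exact ⟨a, ha⟩
  choose γ hγ using hβ
  have lim : Filter.Tendsto β U (nhds γ) := tendsto_pi_nhds.2 fun i =>
    Filter.Tendsto.congr' ((hγ i).mono fun n hn => hn.symm) tendsto_const_nhds
  have limf := (hf.tendsto γ).comp lim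
  refine ⟨γ, tendsto_nhds_unique limf (Filter.Tendsto.prodMk_nhds ?_ ?_)⟩
  · exact tendsto_pi_nhds.2 fun i => Filter.Tendsto.congr'
      ((Filter.eventually_hyperfilter_gt i).mono fun n hn => (h1 n i hn).symm) tendsto_const_nhds
  · exact tendsto_pi_nhds.2 fun i => Filter.Tendsto.congr'
      ((Filter.eventually_hyperfilter_gt i).mono fun n hn => (h2 n i hn).symm) tendsto_const_nhds

/-- The length is at most `s 0`, hence constant along the ultrafilter. The intermediate points
converge in the Cantor space, and each link between limits holds at every precision. -/
theorem reflTransGen_of_forall_chain (hf : Continuous f) (h : ∀ n, Chain f n u v s) :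
    Relation.ReflTransGen (fun a b => (a, b) ∈ Set.range f) u v := by
  choose k hk p h0 hk' hp using h
  set U := Filter.hyperfilter ℕ
  obtain ⟨l, -, hl⟩ := U.exists_eventually_eq_of_le k (s 0) (.of_forall hk)
  choose q hq using fun j i => U.exists_eventually_eq fun n => p n j i
  have hq' : ∀ m j, ∀ᶠ n in U, ∀ i < m, p n j i = q j i := fun m j =>
    (Filter.eventually_all_finite (Set.finite_Iio m)).2 fun i _ => hq j i
  have h0q : q 0 = u := funext fun i => by
    obtain ⟨n, h1, h2⟩ := ((hq 0 i).and (Filter.eventually_hyperfilter_gt i)).exists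
    exact h1.symm.trans (h0 n i h2)
  have hlq : q l = v := funext fun i => by
    obtain ⟨n, h1, h2, h3⟩ := ((hq l i).and ((Filter.eventually_hyperfilter_gt i).and hl)).exists
    exact h1.symm.trans (h3 ▸ hk' n i h2)
  have step : ∀ j < l, (q j, q (j + 1)) ∈ Set.range f := fun j hj =>
    mem_range_of_forall_step hf (s := s) fun m => by
      obtain ⟨n, h1, h2, h3, h4⟩ := ((hq' m j).and ((hq' m (j + 1)).and
        (hl.and (Filter.eventually_hyperfilter_gt m)))).exists
      exact (hp n j (by omega)).mono h4.le h1 h2 fun _ _ => le_rfl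
  have key : ∀ j ≤ l, Relation.ReflTransGen (fun a b => (a, b) ∈ Set.range f) (q 0) (q j) := by
    intro j
    induction j with
    | zero => exact fun _ => .refl
    | succ j ih => exact fun hj => (ih (by omega)).tail (step j (by omega))
  exact h0q ▸ hlq ▸ key l le_rfl

theorem exists_forall_chain (h : (u, v) ∈ Set.range f) : ∃ α, ∀ n, Chain f n u v α := by
  obtain ⟨β, hβ⟩ := h
  -- The entry `1` allows one link, and the rest of the sequence is its witness `β`.
  refine ⟨fun i => Nat.casesOn i 1 β, fun n => ⟨1, le_rfl, fun j => if j = 0 then u else v,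
    by simp, by simp, fun j hj => ?_⟩⟩
  obtain rfl : j = 0 := by omega
  exact ⟨β, by simp [hβ], by simp [hβ], fun i _ => le_rfl⟩

theorem measurableSet_chain (n : ℕ) (u : ℕ → Bool) (s : ℕ → ℕ) :
    MeasurableSet {v | Chain f n u v s} := by
  let r : (ℕ → Bool) → Fin n → Bool := fun v i => v i
  have hr : Measurable r := measurable_pi_lambda _ fun i => measurable_pi_apply _
  have : {v | Chain f n u v s} = r ⁻¹' (r '' {v | Chain f n u v s}) := by
    refine Set.Subset.antisymm (Set.subset_preimage_image _ _) ?_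
    rintro v ⟨v', h, e⟩
    exact Chain.mono h le_rfl (fun _ _ => rfl) (fun i hi => congrFun e ⟨i, hi⟩) fun _ _ => le_rfl
  rw [this]
  exact hr (Set.toFinite _).measurableSet

/-- Every `Σ¹₁` quasi-order on a nonempty standard Borel space is carried by a Borel injection into
the Cantor space to the range of a continuous map on the Baire space. -/
theorem IsSigma11QuasiOrder.exists_continuous_range {Y : Type w} [MeasurableSpace Y]
    [StandardBorelSpace Y] [Nonempty Y] {R : Y → Y → Prop} (hR : IsSigma11QuasiOrder R) :
    ∃ (e : Y → ℕ → Bool) (f : (ℕ → ℕ) → (ℕ → Bool) × (ℕ → Bool)), Measurable e ∧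
      Function.Injective e ∧ Continuous f ∧
      Set.range f = {q | ∃ x y, R x y ∧ (e x, e y) = q} := by
  obtain ⟨e, he, hinj⟩ := MeasurableSpace.measurable_injection_nat_bool_of_countablySeparated Y
  obtain ⟨Z, _, _, _, _, B, hB, hRB⟩ := hR.sigma11
  have hm : Measurable fun q : (Y × Y) × Z => (e q.1.1, e q.1.2) := by fun_prop
  have hA := hB.analyticSet_image hm
  have hE : (fun q : (Y × Y) × Z => (e q.1.1, e q.1.2)) '' B =
      {q | ∃ x y, R x y ∧ (e x, e y) = q} := by
    ext q
    have key : ∀ x y, R x y ↔ ∃ z, ((x, y), z) ∈ B := fun x y => by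
      simpa using Set.ext_iff.1 hRB (x, y)
    constructor
    · rintro ⟨⟨⟨x, y⟩, z⟩, h, rfl⟩
      exact ⟨x, y, (key x y).2 ⟨z, h⟩, rfl⟩
    · rintro ⟨x, y, h, rfl⟩
      obtain ⟨z, hz⟩ := (key x y).1 h
      exact ⟨((x, y), z), hz, rfl⟩
  rw [hE, MeasureTheory.AnalyticSet] at hA
  rcases hA with hA | ⟨f, hf, hA⟩
  · obtain ⟨x⟩ := ‹Nonempty Y›
    exact absurd (show (e x, e x) ∈ {q | ∃ x y, R x y ∧ (e x, e y) = q} from ⟨x, x, hR.refl x, rfl⟩)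
      (by simp [hA])
  · exact ⟨e, f, he, hinj, hf, hA⟩

theorem IsSigma11QuasiOrder.rel_iff_exists_forall_chain {Y : Type w} [MeasurableSpace Y]
    {R : Y → Y → Prop} (hR : IsSigma11QuasiOrder R) {e : Y → ℕ → Bool} (he : Function.Injective e)
    (hf : Continuous f) (hr : Set.range f = {q | ∃ x y, R x y ∧ (e x, e y) = q}) (x y : Y) :
    R x y ↔ ∃ α, ∀ n, Chain f n (e x) (e y) α := by
  constructor
  · exact fun h => exists_forall_chain (hr ▸ ⟨x, y, h, rfl⟩)
  · rintro ⟨α, h⟩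
    have key : ∀ v, Relation.ReflTransGen (fun a b => (a, b) ∈ Set.range f) (e x) v →
        ∃ y, e y = v ∧ R x y := by
      intro v h
      induction h with
      | refl => exact ⟨x, rfl, hR.refl x⟩
      | tail _ h ih =>
        obtain ⟨y, rfl, hy⟩ := ih
        rw [hr] at h
        obtain ⟨y', z, h1, h2⟩ := h
        obtain ⟨h3, h4⟩ := Prod.ext_iff.1 h2
        obtain rfl := he h3
        exact ⟨z, h4, hR.trans _ _ _ hy h1⟩
    obtain ⟨y', h1, h2⟩ := key _ (reflTransGen_of_forall_chain hf h)
    exact he h1 ▸ h2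

end

/-! ### The ambient digraph -/

/-- Vertices of the ambient digraph: a three-point hub, the nodes of the tree of finite words over
`Bool × ℕ` (most recent letter first), and an `ω`-chain of dummies below each node. -/
inductive Vertex
  | hub (i : Fin 3)
  | node (l : List (Bool × ℕ))
  | dummy (l : List (Bool × ℕ)) (m : ℕ)

namespace Vertex

/-- The hub vertices pointing to the node `l`, which record whether `l` is the root, and otherwise
the bit in its last letter. -/
def Mark (i : Fin 3) : List (Bool × ℕ) → Prop
  | [] => i = 1
  | (true, _) :: _ => i ≠ 2
  | (false, _) :: _ => i = 2

/-- The edges of the ambient digraph. -/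
def Adj : Vertex → Vertex → Prop
  | hub i, hub j => i ≠ j ∧ ¬ (i = 2 ∧ j = 0)
  | hub i, node l => Mark i l
  | hub i, dummy _ _ => i = 0
  | _, hub _ => False
  | node l, dummy l' _ => l = l'
  | dummy l m, dummy l' m' => l = l' ∧ m < m'
  | dummy l m, node l' => ∃ b, l' = (b, m) :: l
  | node _, node _ => False

theorem not_adj_self (a : Vertex) : ¬ Adj a a := by
  cases a <;> simp [Adj]

theorem exists_hub_adj (a : Vertex) : ∃ i, Adj (hub i) a := by
  rcases a with i | l | ⟨l, m⟩
  · fin_cases i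
    exacts [⟨1, by simp [Adj]⟩, ⟨0, by simp [Adj]⟩, ⟨1, by simp [Adj]⟩]
  · rcases l with _ | ⟨⟨_ | _, m⟩, l⟩
    exacts [⟨1, rfl⟩, ⟨2, rfl⟩, ⟨0, by simp [Adj, Mark]⟩]
  · exact ⟨0, rfl⟩

theorem exists_hub_adj_adj (i : Fin 3) : ∃ j, Adj (hub i) (hub j) ∧ Adj (hub j) (hub i) := by
  simp only [Adj]
  revert i
  decide

theorem exists_eq_hub {a b : Vertex} (h : Adj a b) (h' : Adj b a) : ∃ i, a = hub i := by
  rcases a with i | l | ⟨l, m⟩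
  · exact ⟨i, rfl⟩
  · rcases b with j | l' | ⟨l', m'⟩ <;> simp [Adj] at h h'
    simp [h] at h'
  · rcases b with j | l' | ⟨l', m'⟩ <;> simp [Adj] at h h'
    · simp [h'] at h
    · omega

theorem hub_rigid (h : Fin 3 → Fin 3)
    (hh : ∀ i j, Adj (hub i) (hub j) ↔ Adj (hub (h i)) (hub (h j))) (i : Fin 3) : h i = i := by
  simp only [Adj] at hh
  revert i h
  decide

/-- The vertices spanned by the words in `N`. -/
def Dom (N : Set (List (Bool × ℕ))) : Set Vertex := fun a =>
  match a with
  | hub _ => True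
  | node l => l ∈ N
  | dummy l _ => l ∈ N

variable {N N' : Set (List (Bool × ℕ))} {l l' : List (Bool × ℕ)} {m m' : ℕ} {b : Bool}

theorem hub_mem_dom (i : Fin 3) : hub i ∈ Dom N := trivial
theorem node_mem_dom : node l ∈ Dom N ↔ l ∈ N := Iff.rfl

/-- Induced embeddings between the subgraphs spanned by `N` and `N'`. -/
structure IsEmb (N N' : Set (List (Bool × ℕ))) (φ : Vertex → Vertex) : Prop where
  mapsTo : ∀ a ∈ Dom N, φ a ∈ Dom N'
  injOn : Set.InjOn φ (Dom N)
  adj_iff : ∀ a ∈ Dom N, ∀ b ∈ Dom N, Adj a b ↔ Adj (φ a) (φ b)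

namespace IsEmb

variable {φ ψ : Vertex → Vertex}

theorem apply_hub (h : IsEmb N N' φ) (i : Fin 3) : φ (hub i) = hub i := by
  have : ∀ i, ∃ j, φ (hub i) = hub j := fun i => by
    obtain ⟨j, h1, h2⟩ := exists_hub_adj_adj i
    exact exists_eq_hub ((h.adj_iff _ (hub_mem_dom _) _ (hub_mem_dom _)).1 h1)
      ((h.adj_iff _ (hub_mem_dom _) _ (hub_mem_dom _)).1 h2)
  choose g hg using this
  rw [hg, hub_rigid g fun i j => by
    rw [← hg, ← hg]
    exact h.adj_iff _ (hub_mem_dom _) _ (hub_mem_dom _)]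

theorem apply_ne_hub (h : IsEmb N N' φ) {a : Vertex} (ha : a ∈ Dom N) (hne : ∀ i, a ≠ hub i)
    (i : Fin 3) : φ a ≠ hub i := fun e =>
  hne i (h.injOn ha (hub_mem_dom i) (e.trans (h.apply_hub i).symm))

theorem hub_adj_iff (h : IsEmb N N' φ) {a : Vertex} (ha : a ∈ Dom N) (i : Fin 3) :
    Adj (hub i) (φ a) ↔ Adj (hub i) a := by
  rw [h.adj_iff _ (hub_mem_dom i) _ ha, h.apply_hub]

theorem apply_dummy (h : IsEmb N N' φ) (hl : l ∈ N) (m : ℕ) : ∃ l' m', φ (dummy l m) = dummy l' m' := by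
  have h1 := h.apply_ne_hub (a := dummy l m) hl (by simp)
  have h2 := h.hub_adj_iff (a := dummy l m) hl
  rcases hφ : φ (dummy l m) with i | l' | ⟨l', m'⟩
  · exact absurd hφ (h1 i)
  · simp only [hφ, Adj] at h2
    rcases l' with _ | ⟨⟨_ | _, k⟩, l'⟩
    · simpa [Mark] using h2 0
    · simpa [Mark] using h2 0
    · simpa [Mark] using h2 1
  · exact ⟨l', m', rfl⟩

theorem apply_node (h : IsEmb N N' φ) (hl : l ∈ N) :
    ∃ l', φ (node l) = node l' ∧ ∀ i, Mark i l' ↔ Mark i l := by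
  have h1 := h.apply_ne_hub (a := node l) hl (by simp)
  have h2 := h.hub_adj_iff (a := node l) hl
  rcases hφ : φ (node l) with i | l' | ⟨l', m'⟩
  · exact absurd hφ (h1 i)
  · exact ⟨l', rfl, by simpa only [hφ, Adj] using h2⟩
  · simp only [hφ, Adj] at h2
    rcases l with _ | ⟨⟨_ | _, k⟩, l⟩
    · simpa [Mark] using h2 0
    · simpa [Mark] using h2 0
    · simpa [Mark] using h2 1

theorem apply_root (h : IsEmb N N' φ) (hN : [] ∈ N) : φ (node []) = node [] := by
  obtain ⟨l', h1, h2⟩ := h.apply_node hN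
  rcases l' with _ | ⟨⟨_ | _, k⟩, l'⟩
  · exact h1
  · simpa [Mark] using h2 1
  · simpa [Mark] using h2 0

theorem apply_dummy_of_apply_node (h : IsEmb N N' φ) (hl : l ∈ N) (hφ : φ (node l) = node l')
    (m : ℕ) : ∃ m', φ (dummy l m) = dummy l' m' := by
  obtain ⟨l₁, m₁, h1⟩ := h.apply_dummy hl m
  have h2 := (h.adj_iff (node l) hl (dummy l m) hl).1 rfl
  rw [hφ, h1] at h2
  obtain rfl : l' = l₁ := h2
  exact ⟨m₁, h1⟩

theorem apply_node_cons (h : IsEmb N N' φ) (hl : l ∈ N) (hbl : (b, m) :: l ∈ N)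
    (hφ : φ (dummy l m) = dummy l' m') : φ (node ((b, m) :: l)) = node ((b, m') :: l') := by
  obtain ⟨l₁, h1, h2⟩ := h.apply_node hbl
  have h3 := (h.adj_iff (dummy l m) hl (node ((b, m) :: l)) hbl).1 ⟨b, rfl⟩
  rw [hφ, h1] at h3
  obtain ⟨b', rfl⟩ := h3
  suffices b' = b by rw [h1, this]
  cases b <;> cases b' <;> first | rfl | simpa [Mark] using h2 2

theorem exists_strictMono (h : IsEmb N N' φ) (hl : l ∈ N) (hφ : φ (node l) = node l') :
    ∃ π : ℕ → ℕ, StrictMono π ∧ ∀ m, φ (dummy l m) = dummy l' (π m) := by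
  choose π hπ using h.apply_dummy_of_apply_node hl hφ
  refine ⟨π, fun m m' hm => ?_, hπ⟩
  have := (h.adj_iff (dummy l m) hl (dummy l m') hl).1 ⟨rfl, hm⟩
  rw [hπ, hπ] at this
  exact this.2

theorem apply_dummy_eq_self (h : IsEmb N N' φ) (h' : IsEmb N' N ψ) (hψ : ∀ a ∈ Dom N, ψ (φ a) = a)
    (hl : l ∈ N) (hφ : φ (node l) = node l) (m : ℕ) : φ (dummy l m) = dummy l m := by
  have hl' : l ∈ N' := by simpa [hφ, node_mem_dom] using h.mapsTo (node l) hl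
  have hψl : ψ (node l) = node l := by simpa [hφ] using hψ (node l) hl
  obtain ⟨π, hπ, h1⟩ := h.exists_strictMono hl hφ
  obtain ⟨ρ, hρ, h2⟩ := h'.exists_strictMono hl' hψl
  have h3 := hψ (dummy l m) hl
  rw [h1, h2] at h3
  have h4 : ρ (π m) = m := by simpa using h3
  have h5 := hπ.le_apply (x := m)
  have h6 := hρ.le_apply (x := π m)
  rw [h1, show π m = m by omega]

theorem apply_node_eq_self (h : IsEmb N N' φ) (h' : IsEmb N' N ψ) (hψ : ∀ a ∈ Dom N, ψ (φ a) = a)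
    (hN : ∀ b l, b :: l ∈ N → l ∈ N) : ∀ l ∈ N, φ (node l) = node l := by
  intro l
  induction l with
  | nil => exact fun hl => h.apply_root hl
  | cons b l ih =>
    intro hl
    obtain ⟨b, m⟩ := b
    have hl' := hN _ _ hl
    exact h.apply_node_cons hl' hl (h.apply_dummy_eq_self h' hψ hl' (ih hl') m)

theorem apply_eq_self (h : IsEmb N N' φ) (h' : IsEmb N' N ψ) (hψ : ∀ a ∈ Dom N, ψ (φ a) = a)
    (hN : ∀ b l, b :: l ∈ N → l ∈ N) {a : Vertex} (ha : a ∈ Dom N) : φ a = a := by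
  rcases a with i | l | ⟨l, m⟩
  · exact h.apply_hub i
  · exact h.apply_node_eq_self h' hψ hN l ha
  · exact h.apply_dummy_eq_self h' hψ ha (h.apply_node_eq_self h' hψ hN l ha) m

theorem subset_of_leftInverse (h : IsEmb N N' φ) (h' : IsEmb N' N ψ)
    (hψ : ∀ a ∈ Dom N, ψ (φ a) = a) (hN : ∀ b l, b :: l ∈ N → l ∈ N) : N ⊆ N' := fun l hl => by
  simpa [h.apply_node_eq_self h' hψ hN l hl, node_mem_dom] using h.mapsTo (node l) hl

end IsEmb

instance : Countable Vertex := by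
  let c : Vertex → Fin 3 ⊕ List (Bool × ℕ) ⊕ List (Bool × ℕ) × ℕ := fun a =>
    match a with
    | hub i => .inl i
    | node l => .inr (.inl l)
    | dummy l m => .inr (.inr (l, m))
  refine Function.Injective.countable (f := c) ?_
  rintro (i | l | ⟨l, m⟩) (i' | l' | ⟨l', m'⟩) h <;> simp_all [c]

theorem infinite_dom (hN : [] ∈ N) : (Dom N).Infinite :=
  Set.infinite_of_injective_forall_mem (f := dummy []) (fun m m' h => by simpa using h)
    fun _ => hN

instance : Infinite Vertex :=
  Infinite.of_injective (dummy []) fun m m' h => by simpa using h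

instance : MeasurableSpace Vertex := ⊤

instance : DiscreteMeasurableSpace Vertex := ⟨fun _ => trivial⟩

end Vertex

/-! ### The tree of a point of the Cantor space -/

/-- The sequence of bits of a word, extended by `false`. -/
def wordBits : List (Bool × ℕ) → ℕ → Bool
  | [] => fun _ => false
  | (b, _) :: l => Function.update (wordBits l) l.length b

/-- The sequence of numbers of a word, extended by `0`. -/
def wordNums : List (Bool × ℕ) → ℕ → ℕ
  | [] => fun _ => 0
  | (_, m) :: l => Function.update (wordNums l) l.length m

/-- The word whose bits are the first `n` bits of `v` and whose numbers are `0`. -/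
def zeroWord (v : ℕ → Bool) : ℕ → List (Bool × ℕ)
  | 0 => []
  | n + 1 => (v n, 0) :: zeroWord v n

/-- The words whose bits are related to `v` through their numbers. -/
def wordSet (f : (ℕ → ℕ) → (ℕ → Bool) × (ℕ → Bool)) (v : ℕ → Bool) : Set (List (Bool × ℕ)) :=
  {l | Chain f l.length (wordBits l) v (wordNums l)}

/-- Addition of a sequence to the numbers of a word. -/
def shiftWord (α : ℕ → ℕ) : List (Bool × ℕ) → List (Bool × ℕ)
  | [] => []
  | (b, m) :: l => (b, m + α l.length) :: shiftWord α l

/-- The action of `shiftWord` on vertices. -/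
def Vertex.shift (α : ℕ → ℕ) : Vertex → Vertex
  | hub i => hub i
  | node l => node (shiftWord α l)
  | dummy l m => dummy (shiftWord α l) (m + α l.length)

section

variable {f : (ℕ → ℕ) → (ℕ → Bool) × (ℕ → Bool)} {u v : ℕ → Bool} {α : ℕ → ℕ}

theorem nil_mem_wordSet : [] ∈ wordSet f v := chain_zero

theorem mem_wordSet_of_cons (b : Bool × ℕ) (l : List (Bool × ℕ)) (h : b :: l ∈ wordSet f v) :
    l ∈ wordSet f v := by
  obtain ⟨b, m⟩ := b
  exact Chain.mono h (by simp) (fun i hi => Function.update_of_ne hi.ne _ _) (fun _ _ => rfl)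
    fun i hi => by simp [wordNums, Function.update_of_ne hi.ne]

theorem length_zeroWord (v : ℕ → Bool) (n : ℕ) : (zeroWord v n).length = n := by
  induction n with
  | zero => rfl
  | succ n ih => simp [zeroWord, ih]

theorem wordBits_zeroWord (v : ℕ → Bool) {n i : ℕ} (hi : i < n) : wordBits (zeroWord v n) i = v i := by
  induction n with
  | zero => omega
  | succ n ih =>
    simp only [zeroWord, wordBits, length_zeroWord, Function.update_apply]
    split_ifs with h
    · rw [h]
    · exact ih (by omega)

theorem wordNums_zeroWord (v : ℕ → Bool) (n : ℕ) : wordNums (zeroWord v n) = fun _ => 0 := by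
  induction n with
  | zero => rfl
  | succ n ih => simp [zeroWord, wordNums, ih]

theorem zeroWord_mem_wordSet (v : ℕ → Bool) (n : ℕ) : zeroWord v n ∈ wordSet f v := by
  have : Chain f n v v fun _ => 0 := chain_self
  refine this.mono (length_zeroWord v n).le (fun i hi => ?_) (fun _ _ => rfl) fun _ _ => Nat.zero_le _
  rw [length_zeroWord] at hi
  exact (wordBits_zeroWord v hi).symm

theorem eq_of_wordSet_subset (h : wordSet f u ⊆ wordSet f v) : u = v := by
  funext i
  have h1 : Chain f _ _ _ _ := h (zeroWord_mem_wordSet u (i + 1))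
  rw [wordNums_zeroWord] at h1
  rw [← h1.eq_of_zero i (by simp [length_zeroWord]), wordBits_zeroWord u (Nat.lt_succ_self i)]

theorem length_shiftWord (α : ℕ → ℕ) (l : List (Bool × ℕ)) : (shiftWord α l).length = l.length := by
  induction l with
  | nil => rfl
  | cons b l ih => simp [shiftWord, ih]

theorem wordBits_shiftWord (α : ℕ → ℕ) (l : List (Bool × ℕ)) :
    wordBits (shiftWord α l) = wordBits l := by
  induction l with
  | nil => rfl
  | cons b l ih => simp [shiftWord, wordBits, ih, length_shiftWord]

theorem wordNums_shiftWord (α : ℕ → ℕ) (l : List (Bool × ℕ)) {i : ℕ} (hi : i < l.length) :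
    wordNums (shiftWord α l) i = wordNums l i + α i := by
  induction l with
  | nil => simp at hi
  | cons b l ih =>
    simp only [shiftWord, wordNums, length_shiftWord, Function.update_apply]
    split_ifs with h
    · rw [h]
    · exact ih (by simp at hi; omega)

theorem shiftWord_injective (α : ℕ → ℕ) : Function.Injective (shiftWord α) := by
  intro l
  induction l with
  | nil => rintro (_ | ⟨b, l⟩) h <;> simp_all [shiftWord]
  | cons b l ih =>
    rintro (_ | ⟨b', l'⟩) h
    · simp [shiftWord] at h
    · simp only [shiftWord, List.cons.injEq, Prod.mk.injEq] at h
      obtain ⟨⟨h1, h2⟩, h3⟩ := h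
      obtain rfl := ih h3
      simp only [Nat.add_right_cancel_iff] at h2
      rw [show b = b' from Prod.ext h1 h2]

theorem mark_shiftWord (i : Fin 3) (l : List (Bool × ℕ)) :
    Vertex.Mark i (shiftWord α l) ↔ Vertex.Mark i l := by
  rcases l with _ | ⟨⟨_ | _, k⟩, l⟩ <;> rfl

theorem Vertex.shift_injective (α : ℕ → ℕ) : Function.Injective (shift α) := by
  rintro (i | l | ⟨l, m⟩) (i' | l' | ⟨l', m'⟩) h <;> simp only [shift, hub.injEq, node.injEq,
    dummy.injEq, reduceCtorEq] at h ⊢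
  · exact h
  · exact shiftWord_injective α h
  · obtain rfl := shiftWord_injective α h.1
    exact ⟨rfl, by omega⟩

theorem Vertex.adj_shift (a b : Vertex) : Adj a b ↔ Adj (shift α a) (shift α b) := by
  rcases a with i | l | ⟨l, m⟩ <;> rcases b with i' | l' | ⟨l', m'⟩ <;> simp only [shift, Adj]
  · exact (mark_shiftWord i l').symm
  · exact (shiftWord_injective α).eq_iff.symm
  · refine exists_congr fun b => ?_
    rw [← (shiftWord_injective α).eq_iff]
    rfl
  · rw [(shiftWord_injective α).eq_iff]
    refine and_congr_right fun h => ?_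
    rw [h, Nat.add_lt_add_iff_right]

theorem shiftWord_mem_wordSet (h : ∀ n, Chain f n u v α) {l : List (Bool × ℕ)}
    (hl : l ∈ wordSet f u) : shiftWord α l ∈ wordSet f v := by
  refine (Chain.add hl (h _)).mono (length_shiftWord α l).le ?_ (fun _ _ => rfl) fun i hi => ?_
  · simp [wordBits_shiftWord]
  · rw [length_shiftWord] at hi
    rw [wordNums_shiftWord α l hi]
    rfl

theorem Vertex.isEmb_shift (h : ∀ n, Chain f n u v α) :
    IsEmb (wordSet f u) (wordSet f v) (shift α) where
  mapsTo := by
    rintro (i | l | ⟨l, m⟩) hl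
    · trivial
    · exact shiftWord_mem_wordSet h hl
    · exact shiftWord_mem_wordSet h hl
  injOn := (shift_injective α).injOn
  adj_iff _ _ _ _ := adj_shift _ _

theorem Vertex.IsEmb.exists_forall_chain {φ : Vertex → Vertex}
    (h : IsEmb (wordSet f u) (wordSet f v) φ) : ∃ α, ∀ n, Chain f n u v α := by
  have hz := zeroWord_mem_wordSet (f := f) u
  choose g hg using fun n => (h.apply_node (hz n))
  have hstep : ∀ n, ∃ m, g (n + 1) = (u n, m) :: g n := fun n => by
    obtain ⟨m, hm⟩ := h.apply_dummy_of_apply_node (hz n) (hg n).1 0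
    have := h.apply_node_cons (hz n) (hz (n + 1)) hm
    exact ⟨m, node.inj ((hg (n + 1)).1.symm.trans this)⟩
  choose α hα using hstep
  have hg0 : g 0 = [] := node.inj ((hg 0).1.symm.trans (h.apply_root (hz 0)))
  have hlen : ∀ n, (g n).length = n := fun n => by
    induction n with
    | zero => simp [hg0]
    | succ n ih => simp [hα, ih]
  have key : ∀ n, ∀ i < n, wordBits (g n) i = u i ∧ wordNums (g n) i = α i := fun n => by
    induction n with
    | zero => simp
    | succ n ih =>
      intro i hi
      simp only [hα, wordBits, wordNums, hlen, Function.update_apply]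
      split_ifs with e
      · simp [e]
      · exact ih i (by omega)
  refine ⟨α, fun n => ?_⟩
  have hmem : g n ∈ wordSet f v := by
    simpa [(hg n).1, node_mem_dom] using h.mapsTo _ (node_mem_dom.2 (hz n))
  exact Chain.mono hmem (hlen n).ge (fun i hi => (key n i hi).1) (fun _ _ => rfl)
    fun i hi => (key n i hi).2.le

end

/-! ### The ambient kei -/

open Vertex

open scoped Classical in
/-- The Boolean value of adjacency. -/
noncomputable def adjBool (a b : Vertex) : Bool := decide (Adj a b)

theorem adjBool_eq_true_iff {a b : Vertex} : adjBool a b = true ↔ Adj a b := by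
  simp [adjBool]

/-- Doubling the vertices of the digraph gives a kei: `p` flips the copies of the out-neighbours of
its vertex. -/
noncomputable def vop (p q : Vertex × Bool) : Vertex × Bool :=
  (q.1, xor (adjBool p.1 q.1) q.2)

/-- Exchange of the two copies of the vertices selected by `t`. -/
def flipBy (t : Vertex → Bool) (p : Vertex × Bool) : Vertex × Bool := (p.1, xor p.2 (t p.1))

theorem flipBy_flipBy (t : Vertex → Bool) (p : Vertex × Bool) : flipBy t (flipBy t p) = p := by
  simp [flipBy]

theorem vop_flipBy (t : Vertex → Bool) (p q : Vertex × Bool) :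
    vop (flipBy t p) (flipBy t q) = flipBy t (vop p q) := by
  simp [vop, flipBy]

theorem vop_distrib (p q r : Vertex × Bool) : vop p (vop q r) = vop (vop p q) (vop p r) := by
  simp [vop, Bool.xor_left_comm]

theorem vop_self (p : Vertex × Bool) : vop p p = p := by
  have h : adjBool p.1 p.1 = false := by simpa [adjBool] using not_adj_self p.1
  simp [vop, h]

theorem vop_vop (p q : Vertex × Bool) : vop p (vop p q) = q := by
  simp [vop]

theorem vop_eq_iff (p q : Vertex × Bool) : vop p q = q ↔ ¬ Adj p.1 q.1 := by
  rw [← adjBool_eq_true_iff, vop, Prod.ext_iff]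
  cases adjBool p.1 q.1 <;> simp

/-- The indexing `g` identifies `op` with the subkei over the vertices spanned by `N`. -/
structure Presents (N : Set (List (Bool × ℕ))) (g : ℕ → Vertex × Bool) (op : ℕ → ℕ → ℕ) : Prop where
  injective : Function.Injective g
  mem_range : ∀ p, p ∈ Set.range g ↔ p.1 ∈ Dom N
  map_op : ∀ i j, g (op i j) = vop (g i) (g j)

/-- The indexing `g` lists the first copy of each vertex before the second. -/
def Normalized (g : ℕ → Vertex × Bool) : Prop :=
  ∀ a i j, g i = (a, false) → g j = (a, true) → i < j

section

variable {N N' : Set (List (Bool × ℕ))} {g h : ℕ → Vertex × Bool} {op op' : ℕ → ℕ → ℕ}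

theorem exists_op (hr : ∀ p, p ∈ Set.range g ↔ p.1 ∈ Dom N) (i j : ℕ) :
    ∃ k, g k = vop (g i) (g j) :=
  (hr _).2 ((hr (g j)).1 ⟨j, rfl⟩)

theorem Presents.isKei (hp : Presents N g op) : IsKei op := by
  have inv : ∀ i j, op i (op i j) = j := fun i j =>
    hp.injective (by rw [hp.map_op, hp.map_op, vop_vop])
  refine ⟨⟨fun i j k => hp.injective ?_, fun i k => ⟨op i k, inv i k, ?_⟩, fun i => hp.injective ?_⟩,
    inv⟩
  · simp only [hp.map_op]
    exact vop_distrib _ _ _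
  · rintro j rfl
    exact (inv i j).symm
  · rw [hp.map_op, vop_self]

theorem Presents.op_eq_iff (hp : Presents N g op) (i j : ℕ) :
    op i j = j ↔ ¬ Adj (g i).1 (g j).1 := by
  rw [← hp.injective.eq_iff, hp.map_op, vop_eq_iff]

theorem Presents.mem_dom (hp : Presents N g op) (i : ℕ) : (g i).1 ∈ Dom N :=
  (hp.mem_range _).1 ⟨i, rfl⟩

theorem Presents.comp_perm (hp : Presents N g op) (σ : Equiv.Perm ℕ)
    (hσ : ∀ i j, σ (op' i j) = op (σ i) (σ j)) : Presents N (g ∘ σ) op' where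
  injective := hp.injective.comp σ.injective
  mem_range p := by rw [σ.surjective.range_comp, hp.mem_range]
  map_op i j := by simp [hσ, hp.map_op]

theorem Presents.exists_normalized (hp : Presents N g op) :
    ∃ g', Presents N g' op ∧ Normalized g' := by
  let t : Vertex → Bool := fun a =>
    decide (Function.invFun g (a, true) < Function.invFun g (a, false))
  have hinv : ∀ i, Function.invFun g (g i) = i := Function.leftInverse_invFun hp.injective
  refine ⟨flipBy t ∘ g, ⟨(Function.LeftInverse.injective (flipBy_flipBy t)).comp hp.injective,
    fun p => ?_, fun i j => ?_⟩, fun a i j hi hj => ?_⟩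
  · rw [show p.1 = (flipBy t p).1 from rfl, ← hp.mem_range]
    constructor
    · rintro ⟨i, rfl⟩
      exact ⟨i, (flipBy_flipBy t _).symm⟩
    · rintro ⟨i, hi⟩
      exact ⟨i, by simp [hi, flipBy_flipBy]⟩
  · simp [hp.map_op, vop_flipBy]
  · replace hi : g i = flipBy t (a, false) := by rw [← hi]; exact (flipBy_flipBy t _).symm
    replace hj : g j = flipBy t (a, true) := by rw [← hj]; exact (flipBy_flipBy t _).symm
    rw [← hinv i, ← hinv j, hi, hj]
    have hne : i ≠ j := by
      rintro rfl
      simpa [flipBy] using hi.symm.trans hj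
    cases hta : t a
    · simp only [flipBy, hta, Bool.xor_false]
      have h1 : ¬ Function.invFun g (a, true) < Function.invFun g (a, false) := by
        simpa [t] using hta
      simp only [flipBy, hta, Bool.xor_false] at hi hj
      rw [← hi, ← hj, hinv, hinv] at h1 ⊢
      omega
    · simp only [flipBy, hta, Bool.xor_true, Bool.not_false, Bool.not_true]
      simpa [t] using hta

theorem Presents.exists_isEmb (hp : Presents N g op) (hp' : Presents N' h op') {f : ℕ → ℕ}
    (hf : Function.Injective f) (hop : ∀ i j, f (op i j) = op' (f i) (f j)) :
    ∃ φ, IsEmb N N' φ ∧ ∀ i, φ (g i).1 = (h (f i)).1 := by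
  have key : ∀ i j, (g i).1 = (g j).1 → (h (f i)).1 = (h (f j)).1 := by
    intro i j hij
    rcases eq_or_ne i j with rfl | hne
    · rfl
    obtain ⟨c, hc⟩ := exists_hub_adj (g i).1
    obtain ⟨k, hk⟩ := (hp.mem_range (hub c, false)).2 (hub_mem_dom c)
    have : op k i = j := hp.injective (by
      rw [hp.map_op, hk, vop, adjBool_eq_true_iff.2 hc]
      refine Prod.ext hij ?_
      have : (g i).2 ≠ (g j).2 := fun e => hne (hp.injective (Prod.ext hij e))
      revert this
      cases (g i).2 <;> cases (g j).2 <;> simp)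
    rw [← this, hop, hp'.map_op]
    rfl
  have hidx : ∀ a, ∀ b, a ∈ Dom N → g (Function.invFun g (a, b)) = (a, b) := fun a b ha =>
    Function.invFun_eq ((hp.mem_range (a, b)).2 ha)
  let φ : Vertex → Vertex := fun a => (h (f (Function.invFun g (a, false)))).1
  have hφ : ∀ i, φ (g i).1 = (h (f i)).1 := fun i => key _ _ (by rw [hidx _ _ (hp.mem_dom i)])
  have hsurj : ∀ a ∈ Dom N, ∀ b, ∃ i, g i = (a, b) := fun a ha b => ⟨_, hidx a b ha⟩
  refine ⟨φ, ⟨fun a ha => hp'.mem_dom _, fun a ha b hb hab => ?_, fun a ha b hb => ?_⟩, hφ⟩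
  · obtain ⟨i, hi⟩ := hsurj a ha false
    obtain ⟨i', hi'⟩ := hsurj a ha true
    obtain ⟨j, hj⟩ := hsurj b hb false
    by_contra hne
    have h1 : i ≠ i' := by rintro rfl; simpa using hi.symm.trans hi'
    have h2 : i ≠ j := by rintro rfl; exact hne (Prod.ext_iff.1 (hi.symm.trans hj)).1
    have h3 : i' ≠ j := by rintro rfl; exact hne (Prod.ext_iff.1 (hi'.symm.trans hj)).1
    have e1 : (h (f i)).1 = φ a := by rw [← hφ, hi]
    have e2 : (h (f i')).1 = φ a := by rw [← hφ, hi']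
    have e3 : (h (f j)).1 = φ a := by rw [← hφ, hj, hab]
    have inj := hp'.injective.comp hf
    have n1 : (h (f i)).2 ≠ (h (f i')).2 := fun e => h1 (inj (Prod.ext (e1.trans e2.symm) e))
    have n2 : (h (f i)).2 ≠ (h (f j)).2 := fun e => h2 (inj (Prod.ext (e1.trans e3.symm) e))
    have n3 : (h (f i')).2 ≠ (h (f j)).2 := fun e => h3 (inj (Prod.ext (e2.trans e3.symm) e))
    revert n1 n2 n3
    cases (h (f i)).2 <;> cases (h (f i')).2 <;> cases (h (f j)).2 <;> simp
  · obtain ⟨i, hi⟩ := hsurj a ha false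
    obtain ⟨j, hj⟩ := hsurj b hb false
    rw [← not_iff_not, show a = (g i).1 by rw [hi], show b = (g j).1 by rw [hj], hφ, hφ,
      ← hp.op_eq_iff, ← hp'.op_eq_iff, ← hop, hf.eq_iff]

theorem Presents.exists_embedding (hp : Presents N g op) (hp' : Presents N' h op')
    {φ : Vertex → Vertex} (hφ : IsEmb N N' φ) :
    ∃ f : ℕ → ℕ, Function.Injective f ∧ ∀ i j, f (op i j) = op' (f i) (f j) := by
  choose f hf using fun i => (hp'.mem_range (φ (g i).1, (g i).2)).2 (hφ.mapsTo _ (hp.mem_dom i))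
  refine ⟨f, fun i j hij => ?_, fun i j => hp'.injective ?_⟩
  · have := (hf i).symm.trans ((congrArg h hij).trans (hf j))
    rw [Prod.mk.injEq] at this
    exact hp.injective (Prod.ext (hφ.injOn (hp.mem_dom i) (hp.mem_dom j) this.1) this.2)
  · rw [hf, hp'.map_op, hf, hf, hp.map_op]
    have : adjBool (g i).1 (g j).1 = adjBool (φ (g i).1) (φ (g j).1) := Bool.eq_iff_iff.2 (by
      simpa only [adjBool_eq_true_iff] using hφ.adj_iff _ (hp.mem_dom i) _ (hp.mem_dom j))
    simp only [vop, this]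

theorem Presents.eq_of_normalized (hp : Presents N g op) (hp' : Presents N' h op)
    (hN : ∀ b l, b :: l ∈ N → l ∈ N) (hn : Normalized g) (hn' : Normalized h) :
    N ⊆ N' ∧ g = h := by
  obtain ⟨φ, hφ, hgh⟩ := hp.exists_isEmb hp' Function.injective_id fun _ _ => rfl
  obtain ⟨ψ, hψ, hhg⟩ := hp'.exists_isEmb hp Function.injective_id fun _ _ => rfl
  simp only [id] at hgh hhg
  have hinv : ∀ a ∈ Dom N, ψ (φ a) = a := fun a ha => by
    obtain ⟨i, hi⟩ := (hp.mem_range (a, false)).2 ha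
    rw [show a = (g i).1 by rw [hi], hgh, hhg]
  refine ⟨hφ.subset_of_leftInverse hψ hinv hN, ?_⟩
  have hfst : ∀ i, (h i).1 = (g i).1 := fun i => by
    rw [← hgh, hφ.apply_eq_self hψ hinv hN (hp.mem_dom i)]
  funext i
  by_contra hne
  have hsnd : (h i).2 = !(g i).2 := by
    have : (g i).2 ≠ (h i).2 := fun e => hne (Prod.ext (hfst i).symm e)
    revert this
    cases (g i).2 <;> cases (h i).2 <;> simp
  obtain ⟨j, hj⟩ := (hp.mem_range ((g i).1, !(g i).2)).2 (hp.mem_dom i)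
  have hij : j ≠ i := by
    rintro rfl
    simpa using congrArg Prod.snd hj
  have hj' : h j = ((g i).1, (g i).2) := by
    have h1 : (h j).1 = (g i).1 := by rw [hfst, hj]
    refine Prod.ext h1 ?_
    have : (h j).2 ≠ (h i).2 := fun e => hij (hp'.injective (Prod.ext (h1.trans (hfst i).symm) e))
    rw [hsnd] at this
    simpa using this
  have hi' : h i = ((g i).1, !(g i).2) := Prod.ext (hfst i) hsnd
  have hi : g i = ((g i).1, (g i).2) := rfl
  generalize (g i).1 = a, (g i).2 = b at hi hj hi' hj'
  cases b
  · exact lt_asymm (hn a i j hi hj) (hn' a j i hj' hi')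
  · exact lt_asymm (hn a j i hj hi) (hn' a i j hi' hj')

end

/-! ### Measurability and invariant universality -/

theorem measurable_apply_of_nat {α β : Type*} [MeasurableSpace α] [MeasurableSpace β]
    {F : α → ℕ → β} {k : α → ℕ} (hF : ∀ n, Measurable fun a => F a n) (hk : Measurable k) :
    Measurable fun a => F a (k a) := by
  have h : Measurable fun p : α × ℕ => F p.1 p.2 := measurable_from_prod_countable_left hF
  exact h.comp (measurable_id.prodMk hk)

theorem measurable_keiSpace_apply (i j : ℕ) : Measurable fun K : KeiSpace => K.1 i j :=
  (measurable_eval_op i j).comp measurable_subtype_coe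

theorem measurableSet_hom : MeasurableSet {q : (KeiSpace × KeiSpace) × (ℕ → ℕ) |
    ∀ x y, q.2 (q.1.1.1 x y) = q.1.2.1 (q.2 x) (q.2 y)} := by
  simp only [Set.ofPred_forall]
  refine .iInter fun x => .iInter fun y => measurableSet_eq_fun ?_ ?_
  · exact measurable_apply_of_nat (F := fun q : (KeiSpace × KeiSpace) × (ℕ → ℕ) => q.2)
      (fun n => (measurable_pi_apply n).comp measurable_snd)
      ((measurable_keiSpace_apply x y).comp (measurable_fst.comp measurable_fst))
  · refine measurable_apply_of_nat
      (F := fun q : (KeiSpace × KeiSpace) × (ℕ → ℕ) => q.1.2.1 (q.2 x)) (fun n => ?_)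
      ((measurable_pi_apply y).comp measurable_snd)
    exact measurable_apply_of_nat
      (F := fun (q : (KeiSpace × KeiSpace) × (ℕ → ℕ)) m => q.1.2.1 m n)
      (fun m => (measurable_keiSpace_apply m n).comp (measurable_snd.comp measurable_fst))
      ((measurable_pi_apply x).comp measurable_snd)

theorem measurableSet_injective {β : Type*} [MeasurableSpace β] [DiscreteMeasurableSpace β]
    [Countable β] : MeasurableSet {f : ℕ → β | Function.Injective f} := by
  simp only [Function.Injective, Set.ofPred_forall]
  refine .iInter fun i => .iInter fun j => ?_
  have : {f : ℕ → β | f i = f j → i = j} = {f | f i = f j}ᶜ ∪ {_f | i = j} := by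
    ext f
    simp [imp_iff_not_or]
  rw [this]
  exact (measurableSet_eq_fun (measurable_pi_apply i) (measurable_pi_apply j)).compl.union (.const _)

theorem measurableSet_surjective : MeasurableSet {f : ℕ → ℕ | Function.Surjective f} := by
  simp only [Function.Surjective, Set.ofPred_forall, Set.ofPred_exists]
  exact .iInter fun j => .iUnion fun i =>
    measurableSet_eq_fun (measurable_pi_apply i) measurable_const

theorem isSigma11Rel_keiEmbeds : IsSigma11Rel KeiEmbeds :=
  ⟨ℕ → ℕ, inferInstance, inferInstance, inferInstance, inferInstance, _,
    (measurable_snd measurableSet_injective).inter measurableSet_hom, rfl⟩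

theorem isSigma11Rel_keiIso : IsSigma11Rel KeiIso := by
  refine ⟨ℕ → ℕ, inferInstance, inferInstance, inferInstance, inferInstance, _,
    ((measurable_snd measurableSet_injective).inter
      (measurable_snd measurableSet_surjective)).inter measurableSet_hom, ?_⟩
  ext ⟨K, M⟩
  constructor
  · rintro ⟨σ, hσ⟩
    exact ⟨σ, ⟨σ.injective, σ.surjective⟩, hσ⟩
  · rintro ⟨f, ⟨h1, h2⟩, h3⟩
    exact ⟨Equiv.ofBijective f ⟨h1, h2⟩, h3⟩

theorem isSigma11QuasiOrder_keiEmbeds : IsSigma11QuasiOrder KeiEmbeds where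
  refl _ := ⟨id, Function.injective_id, fun _ _ => rfl⟩
  trans _ _ _ := by
    rintro ⟨f, hf, hf'⟩ ⟨g, hg, hg'⟩
    exact ⟨g ∘ f, hg.comp hf, fun x y => by simp [hf', hg']⟩
  sigma11 := isSigma11Rel_keiEmbeds

theorem equivalence_keiIso : Equivalence KeiIso where
  refl _ := ⟨Equiv.refl ℕ, fun _ _ => rfl⟩
  symm := by
    rintro K M ⟨σ, hσ⟩
    exact ⟨σ.symm, fun x y => σ.injective (by simp [hσ])⟩
  trans := by
    rintro K M L ⟨σ, hσ⟩ ⟨τ, hτ⟩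
    exact ⟨σ.trans τ, fun x y => by simp [hσ, hτ]⟩

section

variable {Y : Type w} {N : Y → Set (List (Bool × ℕ))}

/-- Points of `Y` with a normalized indexing of the doubled vertices of their trees. -/
def indexings (N : Y → Set (List (Bool × ℕ))) : Set (Y × (ℕ → Vertex × Bool)) :=
  {q | Function.Injective q.2 ∧ (∀ p, p ∈ Set.range q.2 ↔ p.1 ∈ Dom (N q.1)) ∧ Normalized q.2}

/-- The kei structure on `ℕ` transported along an indexing. -/
noncomputable def indexedOp (g : ℕ → Vertex × Bool) (i j : ℕ) : ℕ :=
  Function.invFun g (vop (g i) (g j))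

theorem presents_indexedOp (q : indexings N) : Presents (N q.1.1) q.1.2 (indexedOp q.1.2) :=
  ⟨q.2.1, q.2.2.1, fun i j => Function.invFun_eq (exists_op q.2.2.1 i j)⟩

/-- The kei of an indexing. -/
noncomputable def indexedKei (q : indexings N) : KeiSpace :=
  ⟨indexedOp q.1.2, (presents_indexedOp q).isKei⟩

theorem indexedKei_injective (htail : ∀ x b l, b :: l ∈ N x → l ∈ N x)
    (hsub : ∀ x y, N x ⊆ N y → x = y) :
    Function.Injective (indexedKei (N := N)) := by
  intro q r h
  have h1 := presents_indexedOp q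
  have h2 := presents_indexedOp r
  rw [show indexedOp q.1.2 = indexedOp r.1.2 from congrArg Subtype.val h] at h1
  obtain ⟨h3, h4⟩ := h1.eq_of_normalized h2 (htail _) q.2.2.2 r.2.2.2
  exact Subtype.ext (Prod.ext (hsub _ _ h3) h4)

theorem invariantUnder_range_indexedKei :
    InvariantUnder KeiIso (Set.range (indexedKei (N := N))) := by
  rintro _ K ⟨σ, hσ⟩ ⟨q, rfl⟩
  have h1 : Presents (N q.1.1) (q.1.2 ∘ σ.symm) K.1 :=
    (presents_indexedOp q).comp_perm σ.symm fun i j => σ.injective (by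
      have := hσ (σ.symm i) (σ.symm j)
      simp only [Equiv.apply_symm_apply] at this ⊢
      exact this.symm)
  obtain ⟨g, hg, hn⟩ := h1.exists_normalized
  refine ⟨⟨(q.1.1, g), hg.injective, hg.mem_range, hn⟩, Subtype.ext ?_⟩
  funext i j
  refine hg.injective ?_
  rw [hg.map_op]
  exact (presents_indexedOp ⟨(q.1.1, g), hg.injective, hg.mem_range, hn⟩).map_op i j

theorem keiEmbeds_indexedKei_iff (q r : indexings N) :
    KeiEmbeds (indexedKei q) (indexedKei r) ↔ ∃ φ, IsEmb (N q.1.1) (N r.1.1) φ := by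
  constructor
  · rintro ⟨f, hf, hop⟩
    obtain ⟨φ, hφ, -⟩ := (presents_indexedOp q).exists_isEmb (presents_indexedOp r) hf hop
    exact ⟨φ, hφ⟩
  · rintro ⟨φ, hφ⟩
    exact (presents_indexedOp q).exists_embedding (presents_indexedOp r) hφ

end

section

variable {Y : Type w} [MeasurableSpace Y]

open scoped Classical in
theorem measurable_count {P : Y → ℕ → Prop} (hP : ∀ n, MeasurableSet {x | P x n}) (n : ℕ) :
    Measurable fun x => Nat.count (P x) n := by
  induction n with
  | zero => simp
  | succ n ih =>
    simp only [Nat.count_succ]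
    exact ih.add (Measurable.ite (hP n) measurable_const measurable_const)

open scoped Classical in
theorem measurable_nth {P : Y → ℕ → Prop} (hP : ∀ n, MeasurableSet {x | P x n})
    (hinf : ∀ x, {n | P x n}.Infinite) (i : ℕ) : Measurable fun x => Nat.nth (P x) i := by
  refine measurable_to_countable' fun n => ?_
  have : (fun x => Nat.nth (P x) i) ⁻¹' {n} =
      {x | P x n} ∩ (fun x => Nat.count (P x) n) ⁻¹' {i} := by
    ext x
    constructor
    · rintro rfl
      exact ⟨Nat.nth_mem_of_infinite (hinf x) i, Nat.count_nth_of_infinite (hinf x) i⟩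
    · rintro ⟨h1, rfl⟩
      exact Nat.nth_count h1
  rw [this]
  exact (hP n).inter (measurable_count hP n (.singleton i))

/-- A Borel family of infinite sets of vertices has a Borel family of enumerations of the doubled
sets listing the two copies of each vertex in order. -/
theorem exists_measurable_enumeration {D : Y → Set Vertex}
    (hD : ∀ a, MeasurableSet {x | a ∈ D x}) (hinf : ∀ x, (D x).Infinite) :
    ∃ g : Y → ℕ → Vertex × Bool, Measurable g ∧ ∀ x, Function.Injective (g x) ∧
      (∀ p, p ∈ Set.range (g x) ↔ p.1 ∈ D x) ∧ Normalized (g x) := by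
  obtain ⟨_⟩ := nonempty_denumerable Vertex
  let ε := Denumerable.eqv Vertex
  let P : Y → ℕ → Prop := fun x n => ε.symm n ∈ D x
  have hP : ∀ x, {n | P x n}.Infinite := fun x =>
    (hinf x).preimage (f := ε.symm) fun a _ => ε.symm.surjective a
  let en : Y → ℕ → Vertex := fun x i => ε.symm (Nat.nth (P x) i)
  have hen : ∀ x, Function.Injective (en x) := fun x =>
    ε.symm.injective.comp (Nat.nth_injective (hP x))
  refine ⟨fun x i => (en x (i / 2), decide (i % 2 = 1)), ?_, fun x => ⟨?_, ?_, ?_⟩⟩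
  · refine measurable_pi_lambda _ fun i => Measurable.prodMk ?_ measurable_const
    exact (Measurable.of_discrete (f := ε.symm)).comp (measurable_nth (fun n => hD _) hP _)
  · intro i j hij
    simp only [Prod.mk.injEq, decide_eq_decide] at hij
    have := hen x hij.1
    omega
  · rintro ⟨a, b⟩
    constructor
    · rintro ⟨i, hi⟩
      obtain rfl : en x (i / 2) = a := congrArg Prod.fst hi
      exact Nat.nth_mem_of_infinite (hP x) _
    · intro ha
      have : ε a ∈ Set.range (Nat.nth (P x)) := by
        rw [Nat.range_nth_of_infinite (hP x)]
        simpa [P] using ha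
      obtain ⟨n, hn⟩ := this
      have hn' : en x n = a := by simp [en, hn]
      cases b
      · exact ⟨2 * n, by simp [hn']⟩
      · exact ⟨2 * n + 1, by simp [show (2 * n + 1) / 2 = n by omega, hn']⟩
  · intro a i j hi hj
    simp only [Prod.mk.injEq, decide_eq_false_iff_not, decide_eq_true_eq] at hi hj
    have := hen x (hi.1.trans hj.1.symm)
    omega

variable {N : Y → Set (List (Bool × ℕ))}

theorem measurableSet_mem_dom (hN : ∀ l, MeasurableSet {x | l ∈ N x}) (a : Vertex) :
    MeasurableSet {x | a ∈ Dom (N x)} := by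
  rcases a with i | l | ⟨l, m⟩
  exacts [MeasurableSet.univ, hN l, hN l]

theorem measurableSet_indexings (hN : ∀ l, MeasurableSet {x | l ∈ N x}) :
    MeasurableSet (indexings N) := by
  have hs : ∀ (i : ℕ) (p : Vertex × Bool),
      MeasurableSet {q : Y × (ℕ → Vertex × Bool) | q.2 i = p} := fun i p =>
    measurableSet_eq_fun ((measurable_pi_apply i).comp measurable_snd) measurable_const
  have h1 : MeasurableSet {q : Y × (ℕ → Vertex × Bool) |
      ∀ p, p ∈ Set.range q.2 ↔ p.1 ∈ Dom (N q.1)} := by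
    simp only [Set.ofPred_forall]
    refine .iInter fun p => MeasurableSet.iff ?_ (measurable_fst (measurableSet_mem_dom hN p.1))
    simp only [Set.mem_range, Set.ofPred_exists]
    exact .iUnion fun i => hs i p
  have h2 : MeasurableSet {q : Y × (ℕ → Vertex × Bool) | Normalized q.2} := by
    simp only [Normalized, Set.ofPred_forall]
    exact .iInter fun a => .iInter fun i => .iInter fun j => (hs i _).imp ((hs j _).imp (.const _))
  exact (measurable_snd measurableSet_injective).inter (h1.inter h2)

theorem measurable_indexedKei : Measurable (indexedKei (N := N)) := by
  refine Measurable.subtype_mk (measurable_pi_lambda _ fun i => measurable_pi_lambda _ fun j =>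
    measurable_to_countable' fun k => ?_)
  have he : ∀ i, Measurable fun q : indexings N => q.1.2 i := fun i =>
    (measurable_pi_apply i).comp (measurable_snd.comp measurable_subtype_coe)
  have : (fun q : indexings N => indexedOp q.1.2 i j) ⁻¹' {k} =
      {q | q.1.2 k = vop (q.1.2 i) (q.1.2 j)} := by
    ext q
    rw [Set.mem_preimage, Set.mem_singleton_iff, Set.mem_ofPred_eq, ← (presents_indexedOp q).map_op,
      q.2.1.eq_iff, eq_comm]
  rw [this]
  refine measurableSet_eq_fun (he k) ?_
  exact (Measurable.of_discrete (f := fun r : (Vertex × Bool) × (Vertex × Bool) =>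
    vop r.1 r.2)).comp ((he i).prodMk (he j))

theorem exists_invariant_bireducible [StandardBorelSpace Y]
    (htail : ∀ x b l, b :: l ∈ N x → l ∈ N x)
    (hsub : ∀ x y, N x ⊆ N y → x = y)
    (hnil : ∀ x, [] ∈ N x)
    (hN : ∀ l, MeasurableSet {x | l ∈ N x}) {R : Y → Y → Prop}
    (hR : ∀ x y, R x y ↔ ∃ φ, IsEmb (N x) (N y) φ) :
    ∃ B : Set KeiSpace, MeasurableSet B ∧ InvariantUnder KeiIso B ∧
      BorelBireducible (restrictRel KeiEmbeds B) R := by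
  have : StandardBorelSpace (indexings N) := (measurableSet_indexings hN).standardBorel
  have hemb : MeasurableEmbedding (indexedKei (N := N)) :=
    measurable_indexedKei.measurableEmbedding (indexedKei_injective htail hsub)
  refine ⟨_, hemb.measurableSet_range, invariantUnder_range_indexedKei, ?_, ?_⟩
  · refine ⟨fun K => (Set.rangeSplitting indexedKei K).1.1,
      measurable_fst.comp (measurable_subtype_coe.comp hemb.measurable_rangeSplitting), ?_⟩
    intro K M
    rw [hR, ← keiEmbeds_indexedKei_iff, Set.apply_rangeSplitting indexedKei,
      Set.apply_rangeSplitting indexedKei]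
    rfl
  · obtain ⟨g, hg, hg'⟩ := exists_measurable_enumeration (measurableSet_mem_dom hN)
      fun x => infinite_dom (hnil x)
    let q : Y → indexings N := fun x => ⟨(x, g x), hg' x⟩
    have hq : Measurable q := (measurable_id.prodMk hg).subtype_mk
    exact ⟨fun x => ⟨indexedKei (q x), q x, rfl⟩, (measurable_indexedKei.comp hq).subtype_mk,
      fun x y => (hR x y).trans (keiEmbeds_indexedKei_iff (q x) (q y)).symm⟩

end

theorem mainTheorem7 : InvariantlyUniversal.{0, w} KeiEmbeds KeiIso := by
  refine ⟨isSigma11QuasiOrder_keiEmbeds, equivalence_keiIso, isSigma11Rel_keiIso,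
    fun K M ⟨σ, hσ⟩ => ⟨σ, σ.injective, hσ⟩, fun Y _ _ R hR => ?_⟩
  rcases isEmpty_or_nonempty Y with hY | hY
  · exact ⟨∅, .empty, fun _ _ _ h => h.elim, ⟨fun K => K.2.elim, measurable_of_empty _,
      fun K => K.2.elim⟩, ⟨hY.elim, measurable_of_empty _, hY.elim⟩⟩
  obtain ⟨e, f, he, hinj, hf, hr⟩ := hR.exists_continuous_range
  refine exists_invariant_bireducible (N := fun x => wordSet f (e x))
    (fun x => mem_wordSet_of_cons) (fun x y h => hinj (eq_of_wordSet_subset h))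
    (fun x => nil_mem_wordSet) (fun l => he (measurableSet_chain _ _ _)) fun x y => ?_
  rw [hR.rel_iff_exists_forall_chain hinj hf hr]
  exact ⟨fun ⟨α, h⟩ => ⟨_, isEmb_shift h⟩, fun ⟨φ, h⟩ => h.exists_forall_chain⟩
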